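/- A relation algebra is an algebra $\langle A,\vee,\neg,\circ,{}^{\smallsmile},t\rangle$ such that for all $a,b,c\in A$: (1) $a\vee b=b\vee a$; (2) $a\vee(b\vee c)=(a\vee b)\vee c$; (3) $\neg(\neg a\vee b)\vee\neg(\neg a\vee\neg b)=a$; (4) $a\circ(b\circ c)=(a\circ b)\circ c$; (5) $a\circ t=a$; (6) $a^{\smallsmile\smallsmile}=a$; (7) $(a\circ b)^{\smallsmile}=b^{\smallsmile}\circ a^{\smallsmile}$; (8) $(a\vee b)\circ c=(a\circ c)\vee(b\circ c)$; (9) $(a\vee b)^{\smallsmile}=a^{\smallsmile}\vee b^{\smallsmile}$; (10) $(a^{\smallsmile}\circ\neg(a\circ b))\vee\neg b=\neg b$. Homomorphisms preserve all five operations, and subalgebras are subsets closed under all five operations. A relation algebra is abelian if $a\circ b=b\circ a$ for all $a,b$; let $\mathsf{ARA}$ be the class of all abelian relation algebras. For a modular lattice $L$ with least element $0$, the lattice complex algebra of $L$ is the relation algebra on the power set $P(L)$ in which $\vee$ is union, $\neg$ is set complement, $t=\{0\}$, $X^{\smallsmile}=X$, and $$X\circ Y=\{c\in L : a\vee b=a\vee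 c=b\vee c\ \text{for some}\ a\in X,\ b\in Y\}.$$ Let $\mathsf{LRA}$ be the class of all subalgebras of lattice complex algebras. Let $\mathsf{R}$ be a class of relation algebras. A homomorphism $f:A\to B$ between members of $\mathsf{R}$ is an epimorphism in $\mathsf{R}$ if for every $C\in\mathsf{R}$ and all homomorphisms $g,h:B\to C$, $g\circ f=h\circ f$ implies $g=h$. The class $\mathsf{R}$ has the ES property if every epimorphism in $\mathsf{R}$ is surjective. **Theorem.** Let $\mathsf{R}$ be any class of relation algebras with $\mathsf{LRA}\subseteq\mathsf{R}\subseteq\mathsf{ARA}$. Then $\mathsf{R}$ does not have the ES property: there are $A,B\in\mathsf{R}$ and an epimorphism $f:A\to B$ in $\mathsf{R}$ that is not surjective. -/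

import Mathlib

universe u v

/-- The operations of a relation algebra: join `a ⊔ b`, complement `aᶜ`, fusion (relative product)
`comp a b`, converse `conv a`, and the identity element `ident`. -/
class RelAlgOps (A : Type u) extends Max A, Compl A where
  comp : A → A → A
  conv : A → A
  ident : A

infixl:75 " ⨾ " => RelAlgOps.comp
postfix:max "˘" => RelAlgOps.conv

/-- Relation algebras, by the usual ten equational axioms.  The first three (Huntington's) say that
`⊔` and `ᶜ` are the join and the complement of a Boolean algebra. -/
class RelationAlgebra (A : Type u) extends RelAlgOps A where
  sup_comm' : ∀ a b : A, a ⊔ b = b ⊔ a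
  sup_assoc' : ∀ a b c : A, a ⊔ (b ⊔ c) = (a ⊔ b) ⊔ c
  huntington : ∀ a b : A, (aᶜ ⊔ b)ᶜ ⊔ (aᶜ ⊔ bᶜ)ᶜ = a
  comp_assoc : ∀ a b c : A, a ⨾ (b ⨾ c) = (a ⨾ b) ⨾ c
  comp_ident : ∀ a : A, a ⨾ ident = a
  conv_conv : ∀ a : A, a˘˘ = a
  conv_comp : ∀ a b : A, (a ⨾ b)˘ = b˘ ⨾ a˘
  sup_comp : ∀ a b c : A, (a ⊔ b) ⨾ c = (a ⨾ c) ⊔ (b ⨾ c)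
  conv_sup : ∀ a b : A, (a ⊔ b)˘ = a˘ ⊔ b˘
  residual : ∀ a b : A, (a˘ ⨾ (a ⨾ b)ᶜ) ⊔ bᶜ = bᶜ

/-- Homomorphisms of relation algebras: maps preserving all five operations. -/
structure RelAlgHom (A : Type u) (B : Type v) [RelationAlgebra A] [RelationAlgebra B] where
  toFun : A → B
  map_sup : ∀ a b, toFun (a ⊔ b) = toFun a ⊔ toFun b
  map_compl : ∀ a, toFun aᶜ = (toFun a)ᶜ
  map_comp : ∀ a b, toFun (a ⨾ b) = toFun a ⨾ toFun b
  map_conv : ∀ a, toFun a˘ = (toFun a)˘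
  map_ident : toFun RelAlgOps.ident = RelAlgOps.ident

instance (A : Type u) (B : Type v) [RelationAlgebra A] [RelationAlgebra B] :
    CoeFun (RelAlgHom A B) (fun _ => A → B) := ⟨RelAlgHom.toFun⟩

/-- Subalgebras of a relation algebra: subsets closed under all five operations. -/
structure RelSubalgebra (A : Type u) [RelationAlgebra A] where
  carrier : Set A
  sup_mem : ∀ {a b}, a ∈ carrier → b ∈ carrier → a ⊔ b ∈ carrier
  compl_mem : ∀ {a}, a ∈ carrier → aᶜ ∈ carrier
  comp_mem : ∀ {a b}, a ∈ carrier → b ∈ carrier → a ⨾ b ∈ carrier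
  conv_mem : ∀ {a}, a ∈ carrier → a˘ ∈ carrier
  ident_mem : RelAlgOps.ident ∈ carrier

/-- A subalgebra, with the operations restricted to it, is a relation algebra. -/
instance RelSubalgebra.instRelationAlgebra {A : Type u} [RelationAlgebra A]
    (S : RelSubalgebra A) : RelationAlgebra S.carrier where
  max a b := ⟨a.1 ⊔ b.1, S.sup_mem a.2 b.2⟩
  compl a := ⟨a.1ᶜ, S.compl_mem a.2⟩
  comp a b := ⟨a.1 ⨾ b.1, S.comp_mem a.2 b.2⟩
  conv a := ⟨a.1˘, S.conv_mem a.2⟩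
  ident := ⟨RelAlgOps.ident, S.ident_mem⟩
  sup_comm' a b := Subtype.ext (RelationAlgebra.sup_comm' a.1 b.1)
  sup_assoc' a b c := Subtype.ext (RelationAlgebra.sup_assoc' a.1 b.1 c.1)
  huntington a b := Subtype.ext (RelationAlgebra.huntington a.1 b.1)
  comp_assoc a b c := Subtype.ext (RelationAlgebra.comp_assoc a.1 b.1 c.1)
  comp_ident a := Subtype.ext (RelationAlgebra.comp_ident a.1)
  conv_conv a := Subtype.ext (RelationAlgebra.conv_conv a.1)
  conv_comp a b := Subtype.ext (RelationAlgebra.conv_comp a.1 b.1)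
  sup_comp a b c := Subtype.ext (RelationAlgebra.sup_comp a.1 b.1 c.1)
  conv_sup a b := Subtype.ext (RelationAlgebra.conv_sup a.1 b.1)
  residual a b := Subtype.ext (RelationAlgebra.residual a.1 b.1)

/-- KR frames. -/
structure KRFrame (S : Type u) where
  rel : S → S → S → Prop
  zero : S
  rel_zero : ∀ a b, rel zero a b ↔ a = b
  rel_self : ∀ a, rel a a a
  rel_swap : ∀ {a b c}, rel a b c → rel b a c
  rel_rotate : ∀ {a b c}, rel a b c → rel a c b
  pasch : ∀ {a b c d e}, rel a b c → rel c d e → ∃ f, rel a d f ∧ rel f b e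

/-- The carrier of the complex algebra of a KR frame: the power set of the frame. -/
def KRFrame.ComplexAlgebra {S : Type u} (_F : KRFrame S) : Type u := Set S

/-- The complex algebra of a KR frame: Boolean set operations, fusion
`A ⨾ B = {c | R a b c for some a ∈ A, b ∈ B}`, identity `{0}`, and converse the identity map. -/
instance KRFrame.instRelationAlgebra {S : Type u} (F : KRFrame S) :
    RelationAlgebra F.ComplexAlgebra where
  max (X Y : Set S) := (X ∪ Y : Set S)
  compl (X : Set S) := ({x | x ∉ X} : Set S)
  comp (X Y : Set S) := ({c | ∃ a ∈ X, ∃ b ∈ Y, F.rel a b c} : Set S)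
  conv X := X
  ident := ({F.zero} : Set S)
  sup_comm' (X Y : Set S) := Set.union_comm X Y
  sup_assoc' (X Y Z : Set S) := (Set.union_assoc X Y Z).symm
  huntington (X Y : Set S) := by
    refine Set.ext fun x => ?_
    change (¬ (x ∉ X ∨ x ∈ Y) ∨ ¬ (x ∉ X ∨ x ∉ Y)) ↔ x ∈ X
    tauto
  comp_assoc (X Y Z : Set S) := by
    refine Set.ext fun e => ⟨?_, ?_⟩
    · rintro ⟨a, ha, c, ⟨b, hb, d, hd, hbdc⟩, hace⟩
      obtain ⟨g, h3, h4⟩ := F.pasch hbdc (F.rel_swap hace)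
      exact ⟨g, ⟨a, ha, b, hb, F.rel_swap h3⟩, d, hd, h4⟩
    · rintro ⟨c, ⟨a, ha, b, hb, habc⟩, d, hd, hcde⟩
      obtain ⟨g, h3, h4⟩ := F.pasch (F.rel_swap habc) hcde
      exact ⟨a, ha, g, ⟨b, hb, d, hd, h3⟩, F.rel_swap h4⟩
  comp_ident (X : Set S) := by
    refine Set.ext fun c => ⟨?_, fun hc => ⟨c, hc, F.zero, rfl, F.rel_swap ((F.rel_zero c c).2 rfl)⟩⟩
    rintro ⟨a, ha, b, rfl, h⟩
    exact (F.rel_zero a c).1 (F.rel_swap h) ▸ ha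
  conv_conv _ := rfl
  conv_comp (X Y : Set S) := by
    refine Set.ext fun c => ⟨?_, ?_⟩ <;> rintro ⟨a, ha, b, hb, h⟩ <;>
      exact ⟨b, hb, a, ha, F.rel_swap h⟩
  sup_comp (X Y Z : Set S) := by
    refine Set.ext fun c => ⟨?_, ?_⟩
    · rintro ⟨a, ha | ha, b, hb, h⟩
      · exact Or.inl ⟨a, ha, b, hb, h⟩
      · exact Or.inr ⟨a, ha, b, hb, h⟩
    · rintro (⟨a, ha, b, hb, h⟩ | ⟨a, ha, b, hb, h⟩)
      · exact ⟨a, Or.inl ha, b, hb, h⟩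
      · exact ⟨a, Or.inr ha, b, hb, h⟩
  conv_sup _ _ := rfl
  residual (X Y : Set S) := by
    refine Set.ext fun c => ⟨?_, Or.inr⟩
    rintro (⟨a, ha, b, hb, h⟩ | h)
    · exact fun hc => hb ⟨a, ha, c, hc, F.rel_rotate h⟩
    · exact h

/-- The KR frame of a modular lattice with least element:
`R a b c` iff `a ⊔ b = a ⊔ c = b ⊔ c`, with distinguished element `⊥`. -/
def latticeFrame (L : Type u) [Lattice L] [OrderBot L] [IsModularLattice L] : KRFrame L where
  rel a b c := a ⊔ b = a ⊔ c ∧ a ⊔ c = b ⊔ c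
  zero := ⊥
  rel_zero a b := by
    constructor
    · rintro ⟨h, -⟩
      simpa using h
    · rintro rfl
      simp
  rel_self a := ⟨rfl, rfl⟩
  rel_swap := by
    rintro a b c ⟨h1, h2⟩
    exact ⟨by rw [sup_comm, h1, h2], h2.symm⟩
  rel_rotate := by
    rintro a b c ⟨h1, h2⟩
    exact ⟨h1.symm, by rw [h1, h2, sup_comm]⟩
  pasch := by
    rintro a b c d e ⟨h1, h2⟩ ⟨h3, h4⟩
    have hcab : c ≤ a ⊔ b := h1 ▸ le_sup_right
    have hacb : a ≤ b ⊔ c := h2 ▸ le_sup_left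
    have hbac : b ≤ a ⊔ c := h1 ▸ le_sup_right
    have hecd : e ≤ c ⊔ d := h3 ▸ le_sup_right
    have hcde : c ≤ d ⊔ e := h4 ▸ le_sup_left
    have hdce : d ≤ c ⊔ e := h3 ▸ le_sup_right
    have key : ∀ x p q : L, x ≤ p → p ≤ x ⊔ q → x ⊔ p ⊓ q = p := fun x p q hxp h => by
      rw [inf_comm, ← sup_inf_assoc_of_le q hxp, inf_eq_right]
      exact h
    have i1 : a ⊔ (a ⊔ d) ⊓ (b ⊔ e) = a ⊔ d :=
      key _ _ _ le_sup_left (sup_le le_sup_left (hdce.trans (sup_le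
        (hcab.trans (sup_le_sup_left le_sup_left _)) (le_sup_right.trans le_sup_right))))
    have i2 : d ⊔ (a ⊔ d) ⊓ (b ⊔ e) = a ⊔ d :=
      key _ _ _ le_sup_right (sup_le (hacb.trans (sup_le (le_sup_left.trans le_sup_right)
        (hcde.trans (sup_le_sup_left le_sup_right _)))) le_sup_left)
    have i3 : b ⊔ (a ⊔ d) ⊓ (b ⊔ e) = b ⊔ e := by
      rw [inf_comm]
      exact key _ _ _ le_sup_left (sup_le le_sup_left (hecd.trans (sup_le
        (hcab.trans (sup_le (le_sup_left.trans le_sup_right) le_sup_left))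
        (le_sup_right.trans le_sup_right))))
    have i4 : e ⊔ (a ⊔ d) ⊓ (b ⊔ e) = b ⊔ e := by
      rw [inf_comm]
      exact key _ _ _ le_sup_right (sup_le (hbac.trans (sup_le (le_sup_left.trans le_sup_right)
        (hcde.trans (sup_le (le_sup_right.trans le_sup_right) le_sup_left)))) le_sup_left)
    exact ⟨(a ⊔ d) ⊓ (b ⊔ e), ⟨i1.symm, i1.trans i2.symm⟩,
      ⟨((sup_comm _ _).trans i3).trans (i4.symm.trans (sup_comm _ _)), (sup_comm _ _).trans i4⟩⟩

/-- The lattice complex algebra of a modular lattice with least element. -/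
abbrev LatticeComplexAlgebra (L : Type u) [Lattice L] [OrderBot L] [IsModularLattice L] : Type u :=
  (latticeFrame L).ComplexAlgebra

/-- Bundled relation algebras. -/
structure RelAlg : Type (u + 1) where
  of ::
  carrier : Type u
  [str : RelationAlgebra carrier]

instance : CoeSort RelAlg.{u} (Type u) := ⟨RelAlg.carrier⟩

attribute [instance] RelAlg.str

/-- The class of all subalgebras of lattice complex algebras. -/
def LRA : Set RelAlg.{u} :=
  {A | ∃ (L : Type u) (_ : Lattice L) (_ : OrderBot L) (_ : IsModularLattice L)
    (S : RelSubalgebra (LatticeComplexAlgebra L)), A = RelAlg.of S.carrier}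

/-- The class of all abelian relation algebras. -/
def ARA : Set RelAlg.{u} :=
  {A | ∀ a b : A, a ⨾ b = b ⨾ a}

/-- `f` is an epimorphism of the category whose objects are the algebras in the class `R` and whose
morphisms are the homomorphisms of relation algebras. -/
def IsEpiIn (R : Set RelAlg.{u}) {A B : RelAlg.{u}} (f : RelAlgHom A B) : Prop :=
  ∀ C ∈ R, ∀ g h : RelAlgHom B C, (∀ a, g (f a) = h (f a)) → g = h

/-- The ES property for a class `R`: every epimorphism between members of `R` is surjective. -/
def HasES (R : Set RelAlg.{u}) : Prop :=
  ∀ A ∈ R, ∀ B ∈ R, ∀ f : RelAlgHom A B, IsEpiIn R f → Function.Surjective f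

/-!
The idea is to reduce the statement to modular lattices, where a complement can be unique without
being generated by the elements that determine it.

In an abelian relation algebra `C` the equivalence elements (reflexive, symmetric, idempotent) form
a modular lattice with fusion as join, and a homomorphism from the complex algebra of a modular
lattice `L` to `C` sends principal ideals to equivalence elements, which gives a lattice
homomorphism from `L` (`EquivalenceElement.isModularLattice`, `RelAlgHom.idealHom`).  So lattice
identities in the parameters transfer to every abelian relation algebra.

Take `L = P × Q`, where `P` is the lattice of subspaces of a three-dimensional space over the field
with two elements and `Q` the same over the field with three elements.  Let `d` be a coordinate axis
in `P`, let `s` be a coordinate axis in `Q` and `w` the opposite coordinate plane.  The larger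
algebra is the complex algebra of `L`; the smaller one consists of the sets whose
slices over the `y ≰ w` are saturated with respect to `x ⊔ d = x' ⊔ d` (`saturatedSubalgebra`).  It contains the ideals of
`(x, ⊥)`, of `(⊥, y)` for `y ≤ w`, and of `(d, y)`, but not that of `(⊥, ⊤)`.

A homomorphism on the larger algebra is determined by its values on the smaller one and on the ideal
of `(⊥, s)`.  The latter value is determined too: two candidates for it are complements of the same
element in the same interval, so one is the graph of a "linear map" from the other one to `d`.  Such a
map vanishes, since multiplication by `-1` is trivial on the part over `P` and `1 - (-1)` is
invertible on the part over `Q`.  The lattice-theoretic form of this argument, in which `-1` is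
replaced by a fourth harmonic, is `le_of_complement`.
-/

/-! ### The Boolean algebra underlying a relation algebra -/

namespace RelationAlgebra

variable {A : Type u} [RelationAlgebra A]

instance : Std.Commutative (α := A) (· ⊔ ·) := ⟨sup_comm'⟩

instance : Std.Associative (α := A) (· ⊔ ·) := ⟨fun a b c => (sup_assoc' a b c).symm⟩

lemma sup_compl_eq_sup_compl (a b : A) : a ⊔ aᶜ = b ⊔ bᶜ := by
  -- Expanding `a` and `aᶜ` along `bᶜ`, and `b` and `bᶜ` along `aᶜ`, gives the same four terms.
  have key : ∀ x y z w : A, (x ⊔ y) ⊔ (z ⊔ w) = (x ⊔ z) ⊔ (y ⊔ w) := fun x y z w => by ac_rfl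
  calc a ⊔ aᶜ = ((aᶜ ⊔ bᶜ)ᶜ ⊔ (aᶜ ⊔ bᶜᶜ)ᶜ) ⊔ ((aᶜᶜ ⊔ bᶜ)ᶜ ⊔ (aᶜᶜ ⊔ bᶜᶜ)ᶜ) := by
        rw [huntington a bᶜ, huntington aᶜ bᶜ]
    _ = ((bᶜ ⊔ aᶜ)ᶜ ⊔ (bᶜ ⊔ aᶜᶜ)ᶜ) ⊔ ((bᶜᶜ ⊔ aᶜ)ᶜ ⊔ (bᶜᶜ ⊔ aᶜᶜ)ᶜ) := by
        rw [key, sup_comm' aᶜ bᶜ, sup_comm' aᶜ bᶜᶜ, sup_comm' aᶜᶜ bᶜ, sup_comm' aᶜᶜ bᶜᶜ]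
    _ = b ⊔ bᶜ := by rw [huntington b aᶜ, huntington bᶜ aᶜ]

lemma compl_compl_eq (a : A) : aᶜᶜ = a := by
  have h1 := huntington a aᶜᶜ
  have h2 := huntington aᶜᶜ aᶜ
  rw [sup_comm' aᶜᶜᶜ aᶜᶜ, sup_compl_eq_sup_compl aᶜᶜ aᶜ, sup_comm' aᶜᶜᶜ aᶜ] at h2
  rw [← h2, sup_comm', h1]

/-- The top element.  The choice of the identity element in its definition is immaterial, since
`a ⊔ aᶜ` does not depend on `a`. -/
def one (A : Type u) [RelationAlgebra A] : A := RelAlgOps.ident ⊔ RelAlgOps.identᶜ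

lemma sup_compl (a : A) : a ⊔ aᶜ = one A := sup_compl_eq_sup_compl _ _

lemma compl_sup_self_sup_zero (a : A) : (a ⊔ a)ᶜ ⊔ (one A)ᶜ = aᶜ := by
  have h := huntington aᶜ a
  rwa [compl_compl_eq, sup_compl] at h

lemma one_sup_one : one A ⊔ one A = one A := by
  have h := compl_sup_self_sup_zero (one A)
  have h1 : (one A ⊔ one A)ᶜ ⊔ one A = one A :=
    calc (one A ⊔ one A)ᶜ ⊔ one A = (one A ⊔ one A)ᶜ ⊔ (one A ⊔ (one A)ᶜ) := by rw [sup_compl]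
      _ = one A ⊔ ((one A ⊔ one A)ᶜ ⊔ (one A)ᶜ) := by ac_rfl
      _ = one A := by rw [h, sup_compl]
  calc one A ⊔ one A = one A ⊔ ((one A ⊔ one A)ᶜ ⊔ one A) := by rw [h1]
    _ = (one A ⊔ one A) ⊔ (one A ⊔ one A)ᶜ := by ac_rfl
    _ = one A := sup_compl _

lemma sup_zero (a : A) : a ⊔ (one A)ᶜ = a := by
  have h0 := compl_sup_self_sup_zero (one A)
  rw [one_sup_one] at h0
  have h := compl_sup_self_sup_zero aᶜ
  rw [compl_compl_eq] at h
  conv_lhs => rw [← h]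
  rw [← sup_assoc', h0, h]

lemma sup_self_eq (a : A) : a ⊔ a = a := by
  have h := compl_sup_self_sup_zero a
  rw [sup_zero] at h
  rw [← compl_compl_eq (a ⊔ a), h, compl_compl_eq]

/-- The meet, defined from join and complement by De Morgan's law. -/
def meet (a b : A) : A := (aᶜ ⊔ bᶜ)ᶜ

lemma meet_comm (a b : A) : meet a b = meet b a := by rw [meet, sup_comm', meet]

lemma meet_sup_meet_compl (a b : A) : meet a b ⊔ meet a bᶜ = a := by
  have h := huntington a b
  rw [sup_comm'] at h
  rwa [meet, meet, compl_compl_eq]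

lemma sup_meet (a b : A) : a ⊔ meet a b = a := by
  calc a ⊔ meet a b = (meet a b ⊔ meet a bᶜ) ⊔ meet a b := by rw [meet_sup_meet_compl]
    _ = (meet a b ⊔ meet a b) ⊔ meet a bᶜ := by ac_rfl
    _ = a := by rw [sup_self_eq, meet_sup_meet_compl]

/-- The lattice order `a ≤ b ↔ a ⊔ b = b` of a relation algebra. -/
instance instLattice : Lattice A where
  le a b := a ⊔ b = b
  le_refl := sup_self_eq
  le_trans a b c (hab : _ = _) (hbc : _ = _) := by
    rw [← hbc, sup_assoc', hab]
  le_antisymm a b (hab : _ = _) (hba : _ = _) := by rw [← hab, sup_comm', hba]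
  sup := (· ⊔ ·)
  le_sup_left a b := show a ⊔ (a ⊔ b) = a ⊔ b by rw [sup_assoc', sup_self_eq]
  le_sup_right a b := show b ⊔ (a ⊔ b) = a ⊔ b by rw [sup_comm' a, sup_assoc', sup_self_eq]
  sup_le a b c (hac : _ = _) (hbc : _ = _) := by
    rw [← sup_assoc', hbc, hac]
  inf := meet
  inf_le_left a b := show meet a b ⊔ a = a by rw [sup_comm', sup_meet]
  inf_le_right a b := show meet a b ⊔ b = b by rw [sup_comm', meet_comm, sup_meet]
  le_inf a b c (hab : _ = _) (hac : _ = _) := by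
    have h : ∀ x, a ⊔ x = x → xᶜ ⊔ aᶜ = aᶜ := fun x hx => by
      rw [← hx]
      have := sup_meet aᶜ xᶜ
      rwa [meet, compl_compl_eq, compl_compl_eq, sup_comm'] at this
    have h2 : (bᶜ ⊔ cᶜ) ⊔ aᶜ = aᶜ := by rw [← sup_assoc', h c hac, h b hab]
    have h3 : meet a (meet b c) = a := by
      rw [meet, meet, compl_compl_eq, sup_comm', h2, compl_compl_eq]
    have h4 := sup_meet (meet b c) a
    rwa [meet_comm _ a, h3, sup_comm'] at h4

lemma inf_eq (a b : A) : a ⊓ b = (aᶜ ⊔ bᶜ)ᶜ := rfl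

lemma compl_le_compl_iff {a b : A} : aᶜ ≤ bᶜ ↔ b ≤ a := by
  have h : ∀ {a b : A}, b ≤ a → aᶜ ≤ bᶜ := fun {a b} h => by
    have h1 : b ⊓ a = b := inf_eq_left.2 h
    rw [inf_eq] at h1
    rw [← h1, compl_compl_eq]
    exact le_sup_right
  refine ⟨fun h' => ?_, h⟩
  have := h h'
  rwa [compl_compl_eq, compl_compl_eq] at this

lemma inf_sup_inf_compl (a b : A) : a ⊓ b ⊔ a ⊓ bᶜ = a := meet_sup_meet_compl a b

lemma zero_le (a : A) : (one A)ᶜ ≤ a := sup_eq_right.1 (by rw [sup_comm', sup_zero])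

lemma inf_compl (a : A) : a ⊓ aᶜ = (one A)ᶜ := by
  rw [inf_eq, compl_compl_eq, sup_comm', sup_compl]

lemma inf_compl_le_iff {a b c : A} : a ⊓ bᶜ ≤ c ↔ a ≤ b ⊔ c := by
  constructor
  · intro h
    rw [← inf_sup_inf_compl a b]
    exact sup_le_sup inf_le_right h
  · intro h
    rw [← inf_sup_inf_compl (a ⊓ bᶜ) c]
    refine sup_le inf_le_right ?_
    have h1 : a ⊓ bᶜ ⊓ cᶜ ≤ (b ⊔ c)ᶜ := by
      rw [inf_assoc, inf_eq bᶜ, compl_compl_eq, compl_compl_eq]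
      exact inf_le_right
    calc a ⊓ bᶜ ⊓ cᶜ ≤ (b ⊔ c) ⊓ (b ⊔ c)ᶜ :=
          le_inf ((inf_le_left.trans inf_le_left).trans h) h1
      _ ≤ c := by rw [inf_compl]; exact zero_le c

/-! ### Order properties of fusion and converse -/

lemma comp_mono_left {a b : A} (h : a ≤ b) (c : A) : a ⨾ c ≤ b ⨾ c := by
  rw [← sup_eq_right, ← sup_comp, sup_eq_right.2 h]

lemma conv_mono {a b : A} (h : a ≤ b) : a˘ ≤ b˘ := by
  rw [← sup_eq_right, ← conv_sup, sup_eq_right.2 h]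

lemma conv_ident : (RelAlgOps.ident : A)˘ = RelAlgOps.ident := by
  have h : (RelAlgOps.ident˘ : A) ⨾ RelAlgOps.ident = RelAlgOps.ident˘ := comp_ident _
  have h2 := congrArg RelAlgOps.conv h
  rw [conv_comp, conv_conv, h] at h2
  exact h2

lemma comp_mono_right {a b : A} (h : a ≤ b) (c : A) : c ⨾ a ≤ c ⨾ b := by
  have := conv_mono (comp_mono_left (conv_mono h) c˘)
  simpa only [conv_comp, conv_conv] using this

lemma comp_mono {a b c d : A} (h : a ≤ b) (h' : c ≤ d) : a ⨾ c ≤ b ⨾ d :=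
  (comp_mono_left h c).trans (comp_mono_right h' b)

/-- Schröder's equivalence, in the direction obtained by residuation. -/
lemma comp_le_compl_of_conv_comp_le {a b c : A} (h : a˘ ⨾ b ≤ c) : a ⨾ cᶜ ≤ bᶜ := by
  have h1 : a ⨾ (a˘ ⨾ b)ᶜ ≤ bᶜ := by
    have := residual a˘ b
    rw [conv_conv] at this
    exact sup_eq_right.1 this
  exact (comp_mono_right (compl_le_compl_iff.2 h) a).trans h1

end RelationAlgebra

/-! ### Equivalence elements -/

/-- The equivalence elements of a relation algebra: reflexive, symmetric and idempotent. -/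
def EquivalenceElement (A : Type u) [RelationAlgebra A] : Type u :=
  {e : A // RelAlgOps.ident ≤ e ∧ e˘ = e ∧ e ⨾ e = e}

namespace EquivalenceElement

open RelationAlgebra

variable {A : Type u} [RelationAlgebra A]

instance : PartialOrder (EquivalenceElement A) := Subtype.partialOrder _

/-- In an abelian relation algebra the equivalence elements form a lattice, in which the join is
fusion and the meet is the Boolean meet. -/
abbrev lattice (hA : ∀ a b : A, a ⨾ b = b ⨾ a) : Lattice (EquivalenceElement A) where
  sup e f := ⟨e.1 ⨾ f.1, by
      have := comp_mono e.2.1 f.2.1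
      rwa [comp_ident] at this,
    by rw [conv_comp, e.2.2.1, f.2.2.1, hA],
    by rw [← comp_assoc, comp_assoc f.1, hA f.1 e.1, ← comp_assoc, f.2.2.2, comp_assoc, e.2.2.2]⟩
  le_sup_left e f := by
    have := comp_mono_right f.2.1 e.1
    rwa [comp_ident] at this
  le_sup_right e f := by
    have := comp_mono_right e.2.1 f.1
    rwa [comp_ident, hA] at this
  sup_le e f g he hf := (comp_mono he hf).trans g.2.2.2.le
  inf e f := ⟨e.1 ⊓ f.1, le_inf e.2.1 f.2.1, by
      have h : ∀ g : A, g ≤ e.1 ⊓ f.1 → g˘ ≤ e.1 ⊓ f.1 := fun g hg => le_inf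
        ((conv_mono (hg.trans inf_le_left)).trans e.2.2.1.le)
        ((conv_mono (hg.trans inf_le_right)).trans f.2.2.1.le)
      refine le_antisymm (h _ le_rfl) ?_
      have := conv_mono (h _ le_rfl)
      rwa [conv_conv] at this,
    by
      refine le_antisymm (le_inf ((comp_mono inf_le_left inf_le_left).trans e.2.2.2.le)
        ((comp_mono inf_le_right inf_le_right).trans f.2.2.2.le)) ?_
      have := comp_mono_right (le_inf e.2.1 f.2.1) (e.1 ⊓ f.1)
      rwa [comp_ident] at this⟩
  inf_le_left e f := inf_le_left (a := e.1) (b := f.1)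
  inf_le_right e f := inf_le_right (a := e.1) (b := f.1)
  le_inf e f g hf hg := le_inf (α := A) hf hg

lemma isModularLattice (hA : ∀ a b : A, a ⨾ b = b ⨾ a) :
    @IsModularLattice (EquivalenceElement A) (lattice hA) := by
  let _ := lattice hA
  refine ⟨fun {x} y {z} hxz => ?_⟩
  change (x.1 ⨾ y.1) ⊓ z.1 ≤ x.1 ⨾ (y.1 ⊓ z.1)
  -- Split `y` along `z`; the part of `y` outside `z` stays outside `z` after fusion with `x ≤ z`.
  have h : x.1 ⨾ (z.1ᶜ) ≤ z.1ᶜ := by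
    refine comp_le_compl_of_conv_comp_le ?_
    rw [x.2.2.1]
    exact (comp_mono_left hxz z.1).trans z.2.2.2.le
  have h1 : x.1 ⨾ y.1 ≤ z.1ᶜ ⊔ x.1 ⨾ (y.1 ⊓ z.1) := by
    conv_lhs => rw [← inf_sup_inf_compl y.1 z.1]
    rw [hA, sup_comp]
    refine sup_le ?_ ?_
    · rw [hA]; exact le_sup_right
    · rw [hA]; exact (comp_mono_right inf_le_right _).trans (h.trans le_sup_left)
  have h2 := inf_compl_le_iff.2 h1
  rwa [compl_compl_eq] at h2

end EquivalenceElement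

/-! ### Complements between frames of different characteristic -/

section Frames

variable {E : Type u} [Lattice E] [IsModularLattice E]

lemma sup_inf_cancel {x y z : E} (hxz : x ≤ z) : (x ⊔ y) ⊓ z ≤ x ⊔ y ⊓ z :=
  IsModularLattice.sup_inf_le_assoc_of_le y hxz

/-- Adjoining an element disjoint from `D` preserves meets of elements below `D`. -/
lemma sup_inf_sup_le_of_disjoint [OrderBot E] {T D x y : E} (hT : T ⊓ D ≤ ⊥) (hx : x ≤ D)
    (hy : y ≤ D) : (T ⊔ x) ⊓ (T ⊔ y) ≤ T ⊔ x ⊓ y := by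
  have h : (T ⊔ x) ⊓ D ≤ x :=
    calc (T ⊔ x) ⊓ D = (x ⊔ T) ⊓ D := by rw [sup_comm]
      _ ≤ x ⊔ T ⊓ D := sup_inf_cancel hx
      _ ≤ x := sup_le le_rfl (hT.trans bot_le)
  calc (T ⊔ x) ⊓ (T ⊔ y) = (T ⊔ y) ⊓ (T ⊔ x) := inf_comm _ _
    _ ≤ T ⊔ y ⊓ (T ⊔ x) := sup_inf_cancel le_sup_left
    _ ≤ T ⊔ x ⊓ y := sup_le_sup_left (le_inf ((le_inf inf_le_right (inf_le_left.trans hy)).trans h)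
        inf_le_left) T

/-- Cut down to `s₂ ⊔ d₂`, the element `f ⊔ q ⊔ p` transports the graph `f` of a map `s₁ → d₁` along
the axes of perspectivity `q : s₁ ≅ s₂` and `p : d₁ ≅ d₂`, to the graph of a map `s₂ → d₂`.  This
graph is again disjoint from `d₂`. -/
lemma transport_inf_le [OrderBot E] {d₁ d₂ s₁ p q f : E} (hf : f ⊓ d₁ ≤ ⊥) (hf' : f ≤ s₁ ⊔ d₁)
    (hp : p ≤ d₁ ⊔ d₂) (hpd : p ⊓ d₂ ≤ ⊥) (hq : q ⊓ (s₁ ⊔ d₁ ⊔ d₂) ≤ ⊥)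
    (hs : (s₁ ⊔ d₁) ⊓ (d₁ ⊔ d₂) ≤ d₁) : (f ⊔ q ⊔ p) ⊓ d₂ ≤ ⊥ := by
  have h1 : (f ⊔ q) ⊓ (s₁ ⊔ d₁ ⊔ d₂) ≤ f :=
    (sup_inf_cancel (hf'.trans le_sup_left)).trans (sup_le le_rfl (hq.trans bot_le))
  have h2 : (f ⊔ q) ⊓ (d₁ ⊔ d₂) ≤ ⊥ := by
    have h3 : (f ⊔ q) ⊓ (d₁ ⊔ d₂) ≤ f :=
      (inf_le_inf_left _ (sup_le (le_sup_right.trans le_sup_left) le_sup_right)).trans h1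
    exact (le_inf h3 ((le_inf (h3.trans hf') inf_le_right).trans hs)).trans hf
  have h4 : (f ⊔ q ⊔ p) ⊓ (d₁ ⊔ d₂) ≤ p := by
    rw [sup_comm]
    exact (sup_inf_cancel hp).trans (sup_le le_rfl (h2.trans bot_le))
  exact (le_inf ((inf_le_inf_left _ le_sup_right).trans h4) inf_le_right).trans hpd

/-- The transported graph is again total: together with `d₂` it spans `s₂`. -/
lemma le_transport_sup {d₁ d₂ s₁ s₂ p q f : E} (hd : d₁ ≤ p ⊔ d₂) (hs : s₂ ≤ s₁ ⊔ q)
    (hf : s₁ ≤ f ⊔ d₁) : s₂ ≤ (f ⊔ q ⊔ p) ⊓ (s₂ ⊔ d₂) ⊔ d₂ := by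
  have h : s₂ ≤ (d₂ ⊔ (f ⊔ q ⊔ p)) ⊓ (s₂ ⊔ d₂) := by
    refine le_inf (hs.trans (sup_le (hf.trans (sup_le ?_ (hd.trans (sup_le ?_ ?_)))) ?_))
      le_sup_left
    · exact (le_sup_left.trans le_sup_left).trans le_sup_right
    · exact le_sup_right.trans le_sup_right
    · exact le_sup_left
    · exact (le_sup_right.trans le_sup_left).trans le_sup_right
  rw [sup_comm]
  refine h.trans (sup_inf_cancel le_sup_right)

/-- The graph `f` and its transport intertwine the perspectivities `q` and `p`. -/
lemma axis_le_transport_sup {d₁ d₂ s₁ s₂ p q f : E} (hd : d₁ ≤ p ⊔ d₂) (hq : q ≤ s₁ ⊔ s₂)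
    (hf : s₁ ≤ f ⊔ d₁) : q ≤ f ⊔ (f ⊔ q ⊔ p) ⊓ (s₂ ⊔ d₂) ⊔ p := by
  have h1 : d₁ ≤ f ⊔ p ⊔ (s₂ ⊔ d₂) :=
    hd.trans (sup_le (le_sup_right.trans le_sup_left) (le_sup_right.trans le_sup_right))
  have h : q ≤ (f ⊔ p ⊔ (s₂ ⊔ d₂)) ⊓ (f ⊔ q ⊔ p) := by
    refine le_inf (hq.trans (sup_le (hf.trans (sup_le (le_sup_left.trans le_sup_left) h1)) ?_))
      (le_sup_right.trans le_sup_left)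
    exact le_sup_left.trans le_sup_right
  refine (h.trans (sup_inf_cancel (sup_le_sup_right le_sup_left p))).trans ?_
  refine sup_le (sup_le (le_sup_left.trans le_sup_left) le_sup_right) ?_
  rw [inf_comm]
  exact le_sup_right.trans le_sup_left

/-- If `m₁, m₂, m₃` are independent and `fᵢ, dᵢ ≤ mᵢ` are disjoint, then so are the joins of the
`fᵢ` and of the `dᵢ`. -/
lemma sup_inf_sup_le_bot [OrderBot E] {m₁ m₂ m₃ d₁ d₂ d₃ f₁ f₂ f₃ : E}
    (hf₁ : f₁ ≤ m₁) (hf₂ : f₂ ≤ m₂) (hf₃ : f₃ ≤ m₃) (hd₁ : d₁ ≤ m₁) (hd₂ : d₂ ≤ m₂) (hd₃ : d₃ ≤ m₃)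
    (h₁ : f₁ ⊓ d₁ ≤ ⊥) (h₂ : f₂ ⊓ d₂ ≤ ⊥) (h₃ : f₃ ⊓ d₃ ≤ ⊥)
    (i₁ : m₁ ⊓ (d₁ ⊔ m₂ ⊔ m₃) ≤ d₁) (i₂ : m₂ ⊓ (d₂ ⊔ m₁ ⊔ m₃) ≤ d₂)
    (i₃ : m₃ ⊓ (d₃ ⊔ m₁ ⊔ m₂) ≤ d₃)
    (i : (m₂ ⊔ m₃) ⊓ (m₁ ⊔ m₃) ⊓ (m₁ ⊔ m₂) ≤ ⊥) :
    (f₁ ⊔ f₂ ⊔ f₃) ⊓ (d₁ ⊔ d₂ ⊔ d₃) ≤ ⊥ := by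
  have key : ∀ {m m' m'' d d' d'' f f' f'' : E}, f ≤ m → f' ≤ m' → f'' ≤ m'' → d' ≤ m' → d'' ≤ m'' →
      f ⊓ d ≤ ⊥ → m ⊓ (d ⊔ m' ⊔ m'') ≤ d → (f ⊔ f' ⊔ f'') ⊓ (d ⊔ d' ⊔ d'') ≤ f' ⊔ f'' := by
    intro m m' m'' d d' d'' f f' f'' hf hf' hf'' hd' hd'' h i
    have e : f ⊔ f' ⊔ f'' = f' ⊔ f'' ⊔ f := by rw [sup_assoc, sup_comm]
    have hle : f' ⊔ f'' ≤ d ⊔ m' ⊔ m'' :=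
      sup_le (hf'.trans (le_sup_right.trans le_sup_left)) (hf''.trans le_sup_right)
    calc (f ⊔ f' ⊔ f'') ⊓ (d ⊔ d' ⊔ d'') ≤ (f' ⊔ f'' ⊔ f) ⊓ (d ⊔ m' ⊔ m'') := by
          rw [e]
          exact inf_le_inf_left _ (sup_le_sup (sup_le_sup_left hd' d) hd'')
      _ ≤ f' ⊔ f'' ⊔ f ⊓ (d ⊔ m' ⊔ m'') := sup_inf_cancel hle
      _ ≤ f' ⊔ f'' := sup_le le_rfl
          ((le_inf inf_le_left ((inf_le_inf_right _ hf).trans i)).trans (h.trans bot_le))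
  have k₁ := key hf₁ hf₂ hf₃ hd₂ hd₃ h₁ i₁
  have k₂ := key hf₂ hf₁ hf₃ hd₁ hd₃ h₂ i₂
  have k₃ := key hf₃ hf₁ hf₂ hd₁ hd₂ h₃ i₃
  have e : ∀ x y z : E, y ⊔ x ⊔ z = x ⊔ y ⊔ z := fun x y z => by rw [sup_comm y]
  have e' : ∀ x y z : E, z ⊔ x ⊔ y = x ⊔ y ⊔ z := fun x y z => by rw [sup_assoc, sup_comm]
  rw [e f₁, e d₁] at k₂
  rw [e' f₁, e' d₁] at k₃
  exact (le_inf (le_inf (k₁.trans (sup_le_sup hf₂ hf₃)) (k₂.trans (sup_le_sup hf₁ hf₃)))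
    (k₃.trans (sup_le_sup hf₁ hf₂))).trans i

/-- For a frame of submodules with axes `aᵢ` and diagonals `cᵢⱼ`, the graphs of `x ↦ -x`, this is
the graph of `x ↦ x` over the axes `a₁, a₂`: the fourth harmonic of `c₁₂` with respect to
`a₁, a₂`. -/
def fourthHarmonic (a₁ a₂ a₃ c₁₃ c₂₃ : E) : E :=
  ((a₁ ⊔ c₂₃) ⊓ (a₂ ⊔ c₁₃) ⊔ a₃) ⊓ (a₁ ⊔ a₂)

/-- A frame of order three: independent axes `a₁, a₂, a₃`, and diagonals `c₁₂, c₁₃, c₂₃` which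
are axes of perspectivity between them, such that `c₂₃` is determined by the other two. -/
structure IsFrame {P : Type v} [Lattice P] [OrderBot P] (a₁ a₂ a₃ c₁₂ c₁₃ c₂₃ : P) : Prop where
  disjoint₁ : a₁ ⊓ (a₂ ⊔ a₃) ≤ ⊥
  disjoint₂ : a₂ ⊓ (a₁ ⊔ a₃) ≤ ⊥
  disjoint₃ : a₃ ⊓ (a₁ ⊔ a₂) ≤ ⊥
  triangle : (a₂ ⊔ a₃) ⊓ (a₁ ⊔ a₃) ⊓ (a₁ ⊔ a₂) ≤ ⊥
  c₁₂_le : c₁₂ ≤ a₁ ⊔ a₂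
  c₁₃_le : c₁₃ ≤ a₁ ⊔ a₃
  a₁_le₂ : a₁ ≤ c₁₂ ⊔ a₂
  a₁_le₃ : a₁ ≤ c₁₃ ⊔ a₃
  a₂_le : a₂ ≤ a₁ ⊔ c₁₂
  a₃_le : a₃ ≤ a₁ ⊔ c₁₃
  c₁₂_inf₁ : c₁₂ ⊓ a₁ ≤ ⊥
  c₁₂_inf₂ : c₁₂ ⊓ a₂ ≤ ⊥
  c₁₃_inf₁ : c₁₃ ⊓ a₁ ≤ ⊥
  c₁₃_inf₃ : c₁₃ ⊓ a₃ ≤ ⊥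
  c₂₃_eq : c₂₃ = (c₁₂ ⊔ c₁₃) ⊓ (a₂ ⊔ a₃)

/-- Let `s₁, s₂, s₃` be the axes of a frame in which `-1 ≠ 1`, and `d₁, d₂, d₃` those of an
independent frame in which `-1 = 1`.  If `f` is the graph of a map `s₁ → d₁`, then `f` is `s₁` itself, that
is, the map is zero.

The map is spread along the two frames to a diagonal map of the joins of the axes, with graph `T`.
Adjoining `T` embeds the lattice below the join of the `dᵢ` in the lattice above `T`, and each
element of the `s`-frame lies below the image of the corresponding element of the `d`-frame.  Then
the same holds for the fourth harmonics, so that `s₁ ≤ q₁₂ ⊔ fourthHarmonic s₁ s₂ s₃ q₁₃ q₂₃ ≤ T ⊔ p₁₂`.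
With `s₁ ≤ T ⊔ d₁` and `p₁₂ ⊓ d₁ = ⊥` this gives `s₁ ≤ T`. -/
theorem le_of_complement [OrderBot E] {P Q : Type v} [Lattice P] [OrderBot P] [Lattice Q]
    [OrderBot Q] {d₁ d₂ d₃ p₁₂ p₁₃ p₂₃ : P} {s₁ s₂ s₃ q₁₂ q₁₃ q₂₃ : Q}
    (hP : IsFrame d₁ d₂ d₃ p₁₂ p₁₃ p₂₃) (hQ : IsFrame s₁ s₂ s₃ q₁₂ q₁₃ q₂₃)
    (charP : fourthHarmonic d₁ d₂ d₃ p₁₃ p₂₃ ≤ p₁₂)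
    (charQ : s₁ ≤ q₁₂ ⊔ fourthHarmonic s₁ s₂ s₃ q₁₃ q₂₃)
    (γ : LatticeHom (P × Q) E) (hγ : γ (⊥, ⊥) = ⊥) {f : E} (hf : f ⊓ γ (d₁, ⊥) ≤ ⊥)
    (hf' : f ⊔ γ (d₁, ⊥) = γ (d₁, s₁)) : γ (⊥, s₁) ≤ f := by
  have mono : ∀ {x y : P × Q}, x.1 ≤ y.1 → x.2 ≤ y.2 → γ x ≤ γ y := fun h h' =>
    OrderHomClass.mono γ (show _ ≤ _ from ⟨h, h'⟩)
  have le_bot : ∀ {x : P × Q}, x.1 ≤ ⊥ → x.2 ≤ ⊥ → γ x ≤ ⊥ := fun h h' =>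
    (mono (y := (⊥, ⊥)) h h').trans hγ.le
  have hff : f ≤ γ (⊥, s₁) ⊔ γ (d₁, ⊥) := by
    rw [← map_sup]
    exact (le_sup_left.trans hf'.le).trans (mono (by simp) (by simp))
  have hsf : γ (⊥, s₁) ≤ f ⊔ γ (d₁, ⊥) := by
    rw [hf']
    exact mono bot_le le_rfl
  have hfm : f ≤ γ (d₁, s₁) := le_sup_left.trans hf'.le
  obtain ⟨f₂, hf₂⟩ : ∃ x, x = (f ⊔ γ (⊥, q₁₂) ⊔ γ (p₁₂, ⊥)) ⊓ (γ (⊥, s₂) ⊔ γ (d₂, ⊥)) := ⟨_, rfl⟩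
  obtain ⟨f₃, hf₃⟩ : ∃ x, x = (f ⊔ γ (⊥, q₁₃) ⊔ γ (p₁₃, ⊥)) ⊓ (γ (⊥, s₃) ⊔ γ (d₃, ⊥)) := ⟨_, rfl⟩
  have hd₂ : γ (d₁, ⊥) ≤ γ (p₁₂, ⊥) ⊔ γ (d₂, ⊥) := by
    rw [← map_sup]; exact mono hP.a₁_le₂ bot_le
  have hd₃ : γ (d₁, ⊥) ≤ γ (p₁₃, ⊥) ⊔ γ (d₃, ⊥) := by
    rw [← map_sup]; exact mono hP.a₁_le₃ bot_le
  have hs₂ : γ (⊥, s₂) ≤ γ (⊥, s₁) ⊔ γ (⊥, q₁₂) := by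
    rw [← map_sup]; exact mono bot_le hQ.a₂_le
  have hs₃ : γ (⊥, s₃) ≤ γ (⊥, s₁) ⊔ γ (⊥, q₁₃) := by
    rw [← map_sup]; exact mono bot_le hQ.a₃_le
  have hq₂ : γ (⊥, q₁₂) ≤ γ (⊥, s₁) ⊔ γ (⊥, s₂) := by
    rw [← map_sup]; exact mono bot_le hQ.c₁₂_le
  have hq₃ : γ (⊥, q₁₃) ≤ γ (⊥, s₁) ⊔ γ (⊥, s₃) := by
    rw [← map_sup]; exact mono bot_le hQ.c₁₃_le
  have hfd₂ : f₂ ⊓ γ (d₂, ⊥) ≤ ⊥ := by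
    refine (inf_le_inf_right _ (hf₂.le.trans inf_le_left)).trans
      (transport_inf_le hf hff (p := γ (p₁₂, ⊥)) ?_ ?_ ?_ ?_)
    · rw [← map_sup]; exact mono hP.c₁₂_le bot_le
    · rw [← map_inf]; exact le_bot hP.c₁₂_inf₂ inf_le_left
    · simp only [← map_sup, ← map_inf]
      exact le_bot inf_le_left (by simpa using hQ.c₁₂_inf₁)
    · simp only [← map_sup, ← map_inf]
      exact mono (by simp) (by simp)
  have hfd₃ : f₃ ⊓ γ (d₃, ⊥) ≤ ⊥ := by
    refine (inf_le_inf_right _ (hf₃.le.trans inf_le_left)).trans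
      (transport_inf_le hf hff (p := γ (p₁₃, ⊥)) ?_ ?_ ?_ ?_)
    · rw [← map_sup]; exact mono hP.c₁₃_le bot_le
    · rw [← map_inf]; exact le_bot hP.c₁₃_inf₃ inf_le_left
    · simp only [← map_sup, ← map_inf]
      exact le_bot inf_le_left (by simpa using hQ.c₁₃_inf₁)
    · simp only [← map_sup, ← map_inf]
      exact mono (by simp) (by simp)
  obtain ⟨T, hT⟩ : ∃ T, T = f ⊔ f₂ ⊔ f₃ := ⟨_, rfl⟩
  have fT : f ≤ T := hT ▸ le_sup_left.trans le_sup_left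
  have f₂T : f₂ ≤ T := hT ▸ le_sup_right.trans le_sup_left
  have f₃T : f₃ ≤ T := hT ▸ le_sup_right
  have hTD : T ⊓ γ (d₁ ⊔ d₂ ⊔ d₃, ⊥) ≤ ⊥ := by
    have e : γ (d₁ ⊔ d₂ ⊔ d₃, ⊥) = γ (d₁, ⊥) ⊔ γ (d₂, ⊥) ⊔ γ (d₃, ⊥) := by
      simp only [← map_sup, Prod.mk_sup_mk, sup_idem]
    rw [hT, e]
    refine sup_inf_sup_le_bot (m₁ := γ (d₁, s₁)) (m₂ := γ (d₂, s₂)) (m₃ := γ (d₃, s₃)) hfm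
      (hf₂.le.trans (inf_le_right.trans ?_)) (hf₃.le.trans (inf_le_right.trans ?_))
      (mono le_rfl bot_le) (mono le_rfl bot_le) (mono le_rfl bot_le) hf hfd₂ hfd₃ ?_ ?_ ?_ ?_
    · exact sup_le (mono bot_le le_rfl) (mono le_rfl bot_le)
    · exact sup_le (mono bot_le le_rfl) (mono le_rfl bot_le)
    · simp only [← map_sup, ← map_inf]
      exact mono inf_le_left (by simpa using hQ.disjoint₁)
    · simp only [← map_sup, ← map_inf]
      exact mono inf_le_left (by simpa using hQ.disjoint₂)
    · simp only [← map_sup, ← map_inf]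
      exact mono inf_le_left (by simpa using hQ.disjoint₃)
    · simp only [← map_sup, ← map_inf]
      exact le_bot hP.triangle hQ.triangle
  -- Each element of the `s`-frame lies below `T` joined with its counterpart in the `d`-frame.
  have l₁ : γ (⊥, s₁) ≤ T ⊔ γ (d₁, ⊥) := hsf.trans (sup_le_sup_right fT _)
  have l₂ : γ (⊥, s₂) ≤ T ⊔ γ (d₂, ⊥) :=
    (le_transport_sup hd₂ hs₂ hsf).trans (sup_le_sup_right (hf₂ ▸ f₂T) _)
  have l₃ : γ (⊥, s₃) ≤ T ⊔ γ (d₃, ⊥) :=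
    (le_transport_sup hd₃ hs₃ hsf).trans (sup_le_sup_right (hf₃ ▸ f₃T) _)
  have l₁₂ : γ (⊥, q₁₂) ≤ T ⊔ γ (p₁₂, ⊥) :=
    (axis_le_transport_sup hd₂ hq₂ hsf).trans (sup_le_sup_right (sup_le fT (hf₂ ▸ f₂T)) _)
  have l₁₃ : γ (⊥, q₁₃) ≤ T ⊔ γ (p₁₃, ⊥) :=
    (axis_le_transport_sup hd₃ hq₃ hsf).trans (sup_le_sup_right (sup_le fT (hf₃ ▸ f₃T)) _)
  have lsup : ∀ {x x' : P} {y y' : Q}, γ (⊥, y) ≤ T ⊔ γ (x, ⊥) → γ (⊥, y') ≤ T ⊔ γ (x', ⊥) →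
      γ (⊥, y ⊔ y') ≤ T ⊔ γ (x ⊔ x', ⊥) := by
    intro x x' y y' h h'
    have e : γ (⊥, y ⊔ y') = γ (⊥, y) ⊔ γ (⊥, y') := by simp [← map_sup]
    have e' : γ (x ⊔ x', ⊥) = γ (x, ⊥) ⊔ γ (x', ⊥) := by simp [← map_sup]
    rw [e, e', sup_sup_distrib_left]
    exact sup_le_sup h h'
  have linf : ∀ {x x' : P} {y y' : Q}, x ≤ d₁ ⊔ d₂ ⊔ d₃ → x' ≤ d₁ ⊔ d₂ ⊔ d₃ →
      γ (⊥, y) ≤ T ⊔ γ (x, ⊥) → γ (⊥, y') ≤ T ⊔ γ (x', ⊥) →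
      γ (⊥, y ⊓ y') ≤ T ⊔ γ (x ⊓ x', ⊥) := by
    intro x x' y y' hx hx' h h'
    have e : γ (⊥, y ⊓ y') = γ (⊥, y) ⊓ γ (⊥, y') := by simp [← map_inf]
    have e' : γ (x ⊓ x', ⊥) = γ (x, ⊥) ⊓ γ (x', ⊥) := by simp [← map_inf]
    rw [e, e']
    exact (inf_le_inf h h').trans (sup_inf_sup_le_of_disjoint hTD (mono hx le_rfl)
      (mono hx' le_rfl))
  have b₁ : d₁ ≤ d₁ ⊔ d₂ ⊔ d₃ := le_sup_left.trans le_sup_left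
  have b₂ : d₂ ≤ d₁ ⊔ d₂ ⊔ d₃ := le_sup_right.trans le_sup_left
  have b₃ : d₃ ≤ d₁ ⊔ d₂ ⊔ d₃ := le_sup_right
  have b₁₂ : p₁₂ ≤ d₁ ⊔ d₂ ⊔ d₃ := hP.c₁₂_le.trans (sup_le b₁ b₂)
  have b₁₃ : p₁₃ ≤ d₁ ⊔ d₂ ⊔ d₃ := hP.c₁₃_le.trans (sup_le b₁ b₃)
  have b₂₃ : p₂₃ ≤ d₁ ⊔ d₂ ⊔ d₃ := hP.c₂₃_eq.le.trans (inf_le_right.trans (sup_le b₂ b₃))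
  have l₂₃ : γ (⊥, q₂₃) ≤ T ⊔ γ (p₂₃, ⊥) := by
    rw [hP.c₂₃_eq, hQ.c₂₃_eq]
    exact linf (sup_le b₁₂ b₁₃) (sup_le b₂ b₃) (lsup l₁₂ l₁₃) (lsup l₂ l₃)
  have lh : γ (⊥, fourthHarmonic s₁ s₂ s₃ q₁₃ q₂₃) ≤ T ⊔ γ (fourthHarmonic d₁ d₂ d₃ p₁₃ p₂₃, ⊥) :=
    linf (sup_le (inf_le_left.trans (sup_le b₁ b₂₃)) b₃) (sup_le b₁ b₂)
      (lsup (linf (sup_le b₁ b₂₃) (sup_le b₂ b₁₃) (lsup l₁ l₂₃) (lsup l₂ l₁₃)) l₃) (lsup l₁ l₂)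
  have l : γ (⊥, s₁) ≤ T ⊔ γ (p₁₂, ⊥) := by
    have h : γ (p₁₂ ⊔ fourthHarmonic d₁ d₂ d₃ p₁₃ p₂₃, ⊥) ≤ γ (p₁₂, ⊥) :=
      mono (sup_le le_rfl charP) le_rfl
    have h' : γ (⊥, s₁) ≤ γ (⊥, q₁₂ ⊔ fourthHarmonic s₁ s₂ s₃ q₁₃ q₂₃) := mono bot_le charQ
    exact h'.trans ((lsup l₁₂ lh).trans (sup_le_sup_left h T))
  have lT : γ (⊥, s₁) ≤ T := by
    have h := linf b₁₂ b₁ l l₁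
    rw [inf_idem] at h
    exact h.trans (sup_le le_rfl ((le_bot hP.c₁₂_inf₁ le_rfl).trans bot_le))
  -- Below `d₁ ⊔ s₁`, the graph `T` of the diagonal map is only its first component `f`.
  have hT₁ : T ⊓ γ (d₁, s₁) ≤ f := by
    have h : f₂ ⊔ f₃ ≤ γ (d₂ ⊔ d₃, s₂ ⊔ s₃) :=
      sup_le (hf₂.le.trans (inf_le_right.trans (sup_le (mono bot_le le_sup_left)
        (mono le_sup_left bot_le)))) (hf₃.le.trans (inf_le_right.trans (sup_le
        (mono bot_le le_sup_right) (mono le_sup_right bot_le))))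
    rw [hT, sup_assoc]
    refine (sup_inf_cancel hfm).trans (sup_le le_rfl ((inf_le_inf_right _ h).trans ?_))
    rw [inf_comm, ← map_inf]
    exact (le_bot hP.disjoint₁ hQ.disjoint₁).trans bot_le
  have h : γ (⊥, s₁) ≤ γ (d₁, s₁) := mono bot_le le_rfl
  exact (le_inf lT h).trans hT₁

end Frames

/-! ### The standard frame of a three-dimensional vector space -/

section VectorSpace

variable (K : Type u) [Field K]

/-- The coordinate axis `v j = v k = 0`. -/
def axis (j k : Fin 3) : Submodule K (Fin 3 → K) where
  carrier := {v | v j = 0 ∧ v k = 0}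
  add_mem' := by rintro v w ⟨h1, h2⟩ ⟨h3, h4⟩; simp [h1, h2, h3, h4]
  zero_mem' := by simp
  smul_mem' := by rintro c v ⟨h1, h2⟩; simp [h1, h2]

/-- The line `v i + v j = 0` in the coordinate plane `v k = 0`, where `{i, j, k} = {0, 1, 2}`. -/
def diagonal (i j k : Fin 3) : Submodule K (Fin 3 → K) where
  carrier := {v | v i + v j = 0 ∧ v k = 0}
  add_mem' := by
    rintro v w ⟨h1, h2⟩ ⟨h3, h4⟩
    exact ⟨by simp only [Pi.add_apply]; linear_combination h1 + h3, by simp [h2, h4]⟩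
  zero_mem' := by simp
  smul_mem' := by
    rintro c v ⟨h1, h2⟩
    exact ⟨by simp only [Pi.smul_apply, smul_eq_mul]; linear_combination c * h1, by simp [h2]⟩

variable {K}

lemma mem_diagonal {i j k : Fin 3} {v : Fin 3 → K} :
    v ∈ diagonal K i j k ↔ v i + v j = 0 ∧ v k = 0 := Iff.rfl

lemma eq_zero_of_coords {v : Fin 3 → K} (h0 : v 0 = 0) (h1 : v 1 = 0) (h2 : v 2 = 0) :
    v ∈ (⊥ : Submodule K (Fin 3 → K)) := by
  rw [Submodule.mem_bot]
  ext i
  fin_cases i <;> assumption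

lemma mem_sup_of_eq_add {S T : Submodule K (Fin 3 → K)} {v : Fin 3 → K} (x : Fin 3 → K) (hx : x ∈ S)
    (h : v - x ∈ T) : v ∈ S ⊔ T :=
  Submodule.mem_sup.2 ⟨x, hx, v - x, h, by abel⟩

lemma mem_axis_sup_axis₀₁ {v : Fin 3 → K} : v ∈ axis K 1 2 ⊔ axis K 0 2 ↔ v 2 = 0 := by
  constructor
  · intro h
    obtain ⟨x, ⟨h1, h2⟩, y, ⟨h3, h4⟩, rfl⟩ := Submodule.mem_sup.1 h
    simp only [Pi.add_apply]
    linear_combination h2 + h4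
  · intro h
    refine mem_sup_of_eq_add ![v 0, 0, 0] ⟨?_, ?_⟩ ⟨?_, ?_⟩ <;> (simp; try linear_combination h)

lemma mem_axis_sup_axis₀₂ {v : Fin 3 → K} : v ∈ axis K 1 2 ⊔ axis K 0 1 ↔ v 1 = 0 := by
  constructor
  · intro h
    obtain ⟨x, ⟨h1, h2⟩, y, ⟨h3, h4⟩, rfl⟩ := Submodule.mem_sup.1 h
    simp only [Pi.add_apply]
    linear_combination h1 + h4
  · intro h
    refine mem_sup_of_eq_add ![v 0, 0, 0] ⟨?_, ?_⟩ ⟨?_, ?_⟩ <;> (simp; try linear_combination h)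

lemma mem_axis_sup_axis₁₂ {v : Fin 3 → K} : v ∈ axis K 0 2 ⊔ axis K 0 1 ↔ v 0 = 0 := by
  constructor
  · intro h
    obtain ⟨x, ⟨h1, h2⟩, y, ⟨h3, h4⟩, rfl⟩ := Submodule.mem_sup.1 h
    simp only [Pi.add_apply]
    linear_combination h1 + h3
  · intro h
    refine mem_sup_of_eq_add ![0, v 1, 0] ⟨?_, ?_⟩ ⟨?_, ?_⟩ <;> (simp; try linear_combination h)

lemma mem_diagonal_sup_diagonal {v : Fin 3 → K} :
    v ∈ diagonal K 0 1 2 ⊔ diagonal K 0 2 1 ↔ v 0 + v 1 + v 2 = 0 := by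
  constructor
  · intro h
    obtain ⟨x, ⟨h1, h2⟩, y, ⟨h3, h4⟩, rfl⟩ := Submodule.mem_sup.1 h
    simp only [Pi.add_apply]
    linear_combination h1 + h2 + h3 + h4
  · intro h
    refine mem_sup_of_eq_add ![-v 1, v 1, 0] ⟨?_, ?_⟩ ⟨?_, ?_⟩ <;> (simp; try linear_combination h)

lemma mem_axis_sup_diagonal₁₂ {v : Fin 3 → K} :
    v ∈ axis K 1 2 ⊔ diagonal K 1 2 0 ↔ v 1 + v 2 = 0 := by
  constructor
  · intro h
    obtain ⟨x, ⟨h1, h2⟩, y, ⟨h3, h4⟩, rfl⟩ := Submodule.mem_sup.1 h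
    simp only [Pi.add_apply]
    linear_combination h1 + h2 + h3
  · intro h
    refine mem_sup_of_eq_add ![v 0, 0, 0] ⟨?_, ?_⟩ ⟨?_, ?_⟩ <;> (simp; try linear_combination h)

lemma mem_axis_sup_diagonal₀₂ {v : Fin 3 → K} :
    v ∈ axis K 0 2 ⊔ diagonal K 0 2 1 ↔ v 0 + v 2 = 0 := by
  constructor
  · intro h
    obtain ⟨x, ⟨h1, h2⟩, y, ⟨h3, h4⟩, rfl⟩ := Submodule.mem_sup.1 h
    simp only [Pi.add_apply]
    linear_combination h1 + h2 + h3
  · intro h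
    refine mem_sup_of_eq_add ![0, v 1, 0] ⟨?_, ?_⟩ ⟨?_, ?_⟩ <;> (simp; try linear_combination h)

lemma isFrame_axis_diagonal : IsFrame (axis K 1 2) (axis K 0 2) (axis K 0 1) (diagonal K 0 1 2)
    (diagonal K 0 2 1) (diagonal K 1 2 0) where
  disjoint₁ v h := eq_zero_of_coords (mem_axis_sup_axis₁₂.1 h.2) h.1.1 h.1.2
  disjoint₂ v h := eq_zero_of_coords h.1.1 (mem_axis_sup_axis₀₂.1 h.2) h.1.2
  disjoint₃ v h := eq_zero_of_coords h.1.1 h.1.2 (mem_axis_sup_axis₀₁.1 h.2)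
  triangle v h := eq_zero_of_coords (mem_axis_sup_axis₁₂.1 h.1.1) (mem_axis_sup_axis₀₂.1 h.1.2)
    (mem_axis_sup_axis₀₁.1 h.2)
  c₁₂_le v h := mem_axis_sup_axis₀₁.2 h.2
  c₁₃_le v h := mem_axis_sup_axis₀₂.2 h.2
  a₁_le₂ := by
    intro v ⟨h1, h2⟩
    refine mem_sup_of_eq_add ![v 0, -v 0, 0] ⟨?_, ?_⟩ ⟨?_, ?_⟩ <;> simp [h2]
  a₁_le₃ := by
    intro v ⟨h1, h2⟩
    refine mem_sup_of_eq_add ![v 0, 0, -v 0] ⟨?_, ?_⟩ ⟨?_, ?_⟩ <;> simp [h1]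
  a₂_le := by
    intro v ⟨h1, h2⟩
    refine mem_sup_of_eq_add ![v 1, 0, 0] ⟨?_, ?_⟩ ⟨?_, ?_⟩ <;> simp [h1, h2]
  a₃_le := by
    intro v ⟨h1, h2⟩
    refine mem_sup_of_eq_add ![v 2, 0, 0] ⟨?_, ?_⟩ ⟨?_, ?_⟩ <;> simp [h1, h2]
  c₁₂_inf₁ := by
    rintro v ⟨⟨h1, h2⟩, h3, h4⟩
    exact eq_zero_of_coords (by simpa [h3] using h1) h3 h2
  c₁₂_inf₂ := by
    rintro v ⟨⟨h1, h2⟩, h3, h4⟩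
    exact eq_zero_of_coords h3 (by simpa [h3] using h1) h2
  c₁₃_inf₁ := by
    rintro v ⟨⟨h1, h2⟩, h3, h4⟩
    exact eq_zero_of_coords (by simpa [h4] using h1) h2 h4
  c₁₃_inf₃ := by
    rintro v ⟨⟨h1, h2⟩, h3, h4⟩
    exact eq_zero_of_coords h3 h2 (by simpa [h3] using h1)
  c₂₃_eq := by
    ext v
    rw [Submodule.mem_inf, mem_diagonal_sup_diagonal, mem_axis_sup_axis₁₂, mem_diagonal]
    refine and_congr_left fun h => ?_
    rw [h, zero_add]

lemma mem_fourthHarmonic {v : Fin 3 → K} :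
    v ∈ fourthHarmonic (axis K 1 2) (axis K 0 2) (axis K 0 1) (diagonal K 0 2 1)
      (diagonal K 1 2 0) ↔ v 0 = v 1 ∧ v 2 = 0 := by
  rw [fourthHarmonic, Submodule.mem_inf, mem_axis_sup_axis₀₁]
  refine and_congr_left fun _ => ⟨fun h => ?_, fun h => ?_⟩
  · obtain ⟨x, ⟨h1, h2⟩, y, ⟨h3, h4⟩, rfl⟩ := Submodule.mem_sup.1 h
    have h5 := mem_axis_sup_diagonal₁₂.1 h1
    have h6 := mem_axis_sup_diagonal₀₂.1 h2
    simp only [Pi.add_apply]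
    linear_combination h6 - h5 + h3 - h4
  · refine mem_sup_of_eq_add ![v 0, v 0, -v 0] ⟨mem_axis_sup_diagonal₁₂.2 ?_,
      mem_axis_sup_diagonal₀₂.2 ?_⟩ ⟨?_, ?_⟩ <;> simp [h]

/-- In characteristic two, the graphs of `x ↦ x` and of `x ↦ -x` coincide. -/
lemma fourthHarmonic_le_diagonal (hK : (2 : K) = 0) :
    fourthHarmonic (axis K 1 2) (axis K 0 2) (axis K 0 1) (diagonal K 0 2 1)
      (diagonal K 1 2 0) ≤ diagonal K 0 1 2 := by
  intro v h
  obtain ⟨h1, h2⟩ := mem_fourthHarmonic.1 h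
  exact ⟨by linear_combination h1 + v 1 * hK, h2⟩

/-- In characteristic other than two, the graphs of `x ↦ x` and of `x ↦ -x` span the coordinate
plane, by halving. -/
lemma axis_le_diagonal_sup_fourthHarmonic (hK : (2 : K) ≠ 0) :
    axis K 1 2 ≤ diagonal K 0 1 2 ⊔ fourthHarmonic (axis K 1 2) (axis K 0 2) (axis K 0 1)
      (diagonal K 0 2 1) (diagonal K 1 2 0) := by
  intro v ⟨h1, h2⟩
  refine mem_sup_of_eq_add ![v 0 / 2, -(v 0 / 2), 0] ⟨?_, ?_⟩ (mem_fourthHarmonic.2 ⟨?_, ?_⟩)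
  · simp
  · simp
  · simp only [Pi.sub_apply, h1]
    simp
    field_simp
    ring
  · simp [h2]

lemma axis_sup_plane : axis K 1 2 ⊔ (axis K 0 2 ⊔ axis K 0 1) = ⊤ := by
  refine eq_top_iff.2 fun v _ => ?_
  refine mem_sup_of_eq_add ![v 0, 0, 0] ⟨?_, ?_⟩ (mem_axis_sup_axis₁₂.2 ?_) <;> simp

lemma exists_axis_ne_zero : ∃ v : Fin 3 → K, v ∈ axis K 1 2 ∧ v 0 ≠ 0 :=
  ⟨![1, 0, 0], ⟨by simp, by simp⟩, by simp⟩

end VectorSpace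

/-! ### Principal ideals in lattice complex algebras -/

section Ideals

open RelationAlgebra

variable {L : Type u} [Lattice L] [OrderBot L] [IsModularLattice L]

/-- The principal ideal of `l`, as an element of the lattice complex algebra. -/
def principalIdeal (l : L) : LatticeComplexAlgebra L := (Set.Iic l : Set L)

lemma latticeFrame_le {a b c : L} (h : (latticeFrame L).rel a b c) : c ≤ a ⊔ b :=
  le_sup_right.trans h.1.ge

lemma principalIdeal_comp (l m : L) :
    principalIdeal l ⨾ principalIdeal m = principalIdeal (l ⊔ m) := by
  refine Set.ext fun c => ⟨?_, fun (hc : c ≤ l ⊔ m) => ?_⟩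
  · rintro ⟨a, ha, b, hb, h⟩
    exact (latticeFrame_le h).trans (sup_le_sup ha hb)
  · have h1 : l ⊓ (c ⊔ m) ⊔ c = (l ⊔ c) ⊓ (c ⊔ m) := by
      rw [sup_comm, ← sup_inf_assoc_of_le l le_sup_left, sup_comm c l]
    have h2 : m ⊓ (c ⊔ l) ⊔ c = (l ⊔ c) ⊓ (c ⊔ m) := by
      rw [sup_comm, ← sup_inf_assoc_of_le m le_sup_left, sup_comm c l, inf_comm]
    have h3 : l ⊓ (c ⊔ m) ⊔ m ⊓ (c ⊔ l) = (l ⊔ c) ⊓ (c ⊔ m) := by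
      rw [← sup_inf_assoc_of_le m (inf_le_left.trans le_sup_right), sup_comm _ m,
        ← sup_inf_assoc_of_le l le_sup_right, inf_comm (m ⊔ l),
        inf_eq_left.2 (sup_le (hc.trans (sup_comm l m).le) le_sup_left), inf_comm, sup_comm c l]
    exact ⟨l ⊓ (c ⊔ m), inf_le_left, m ⊓ (c ⊔ l), inf_le_left, h3.trans h1.symm, h1.trans h2.symm⟩

lemma principalIdeal_inf (l m : L) :
    principalIdeal l ⊓ principalIdeal m = principalIdeal (l ⊓ m) := by
  refine Set.ext fun c => ?_
  change ¬ (¬ c ≤ l ∨ ¬ c ≤ m) ↔ c ≤ l ⊓ m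
  rw [le_inf_iff]
  tauto

lemma principalIdeal_bot : principalIdeal (⊥ : L) = RelAlgOps.ident := Set.Iic_bot

variable {C : Type v} [RelationAlgebra C]

lemma RelAlgHom.map_inf {A : Type u} [RelationAlgebra A] (g : RelAlgHom A C) (a b : A) :
    g (a ⊓ b) = g a ⊓ g b := by
  rw [inf_eq, g.map_compl, g.map_sup, g.map_compl, g.map_compl, inf_eq]

/-- A homomorphism from a lattice complex algebra to an abelian relation algebra restricts to a
lattice homomorphism on principal ideals. -/
def RelAlgHom.idealHom (g : RelAlgHom (LatticeComplexAlgebra L) C)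
    (hC : ∀ a b : C, a ⨾ b = b ⨾ a) :
    letI := EquivalenceElement.lattice hC
    LatticeHom L (EquivalenceElement C) :=
  letI := EquivalenceElement.lattice hC
  { toFun := fun l => ⟨g (principalIdeal l), by
      have h : principalIdeal ⊥ ⊓ principalIdeal l = principalIdeal ⊥ := by
        rw [principalIdeal_inf, bot_inf_eq]
      rw [← g.map_ident, ← principalIdeal_bot, ← inf_eq_left, ← g.map_inf, h],
      (g.map_conv _).symm, by rw [← g.map_comp, principalIdeal_comp, sup_idem]⟩
    map_sup' := fun l m => Subtype.ext (by
      change g _ = g _ ⨾ g _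
      rw [← g.map_comp, principalIdeal_comp])
    map_inf' := fun l m => Subtype.ext (by
      change g _ = g _ ⊓ g _
      rw [← g.map_inf, principalIdeal_inf]) }

end Ideals

/-! ### The subalgebra of saturated sets -/

section Saturated

variable {P Q : Type u} [Lattice P] [OrderBot P] [IsModularLattice P]
  [Lattice Q] [OrderBot Q] [IsModularLattice Q]

instance : IsModularLattice (P × Q) :=
  ⟨fun {_} y {_} h => ⟨IsModularLattice.sup_inf_le_assoc_of_le y.1 h.1,
    IsModularLattice.sup_inf_le_assoc_of_le y.2 h.2⟩⟩

/-- The classes of `x ⊔ d = x' ⊔ d` are compatible with the frame relation, because `c` and `c'` in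
the same class are related through an element below `d`. -/
lemma exists_latticeFrame_of_sup_eq {d a b c c' : P} (h : (latticeFrame P).rel a b c)
    (hc : c ⊔ d = c' ⊔ d) : ∃ a', a' ⊔ d = a ⊔ d ∧ (latticeFrame P).rel a' b c' := by
  have h1 : (c ⊔ c') ⊓ d ⊔ c = c ⊔ c' := by
    rw [sup_comm, inf_comm, ← sup_inf_assoc_of_le d le_sup_left, inf_eq_right]
    exact sup_le le_sup_left (le_sup_left.trans hc.ge)
  have h2 : (c ⊔ c') ⊓ d ⊔ c' = c ⊔ c' := by
    rw [sup_comm, inf_comm, ← sup_inf_assoc_of_le d le_sup_right, inf_eq_right]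
    exact sup_le (le_sup_left.trans hc.le) le_sup_left
  have h3 : (latticeFrame P).rel c ((c ⊔ c') ⊓ d) c' :=
    ⟨(sup_comm _ _).trans h1, h2.symm⟩
  obtain ⟨f, h4, h5⟩ := (latticeFrame P).pasch h h3
  refine ⟨f, ?_, h5⟩
  have hd : (c ⊔ c') ⊓ d ⊔ d = d := sup_eq_right.2 inf_le_right
  have h6 : a ⊔ d = a ⊔ (c ⊔ c') ⊓ d ⊔ d := by rw [sup_assoc, hd]
  have h7 : f ⊔ d = (c ⊔ c') ⊓ d ⊔ f ⊔ d := by rw [sup_comm _ f, sup_assoc, hd]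
  rw [h6, h7, h4.1, h4.2]

/-- A set is saturated if its slices over all elements `y` of the second factor outside the ideal of
`w` are unions of classes of the relation `x ⊔ d = x' ⊔ d`. -/
def IsSaturated (d : P) (w : Q) (X : Set (P × Q)) : Prop :=
  ∀ x x' y, ¬ y ≤ w → x ⊔ d = x' ⊔ d → (x, y) ∈ X → (x', y) ∈ X

/-- The subalgebra of saturated sets. -/
def saturatedSubalgebra (d : P) (w : Q) : RelSubalgebra (LatticeComplexAlgebra (P × Q)) where
  carrier := {X | IsSaturated d w X}
  sup_mem hX hY x x' y hy hx := Or.imp (hX x x' y hy hx) (hY x x' y hy hx)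
  compl_mem hX x x' y hy hx h h' := h (hX x' x y hy hx.symm h')
  comp_mem {X Y} hX hY := by
    rintro c c' z hz hc ⟨⟨a, y₁⟩, ha, ⟨b, y₂⟩, hb, h⟩
    obtain ⟨h1, h2⟩ := Prod.mk.inj h.1
    obtain ⟨h3, h4⟩ := Prod.mk.inj h.2
    have hP : (latticeFrame P).rel a b c := ⟨h1, h3⟩
    have hQ : (latticeFrame Q).rel y₁ y₂ z := ⟨h2, h4⟩
    by_cases hy : y₁ ≤ w
    · have hy₂ : ¬ y₂ ≤ w := fun h' => hz ((latticeFrame_le hQ).trans (sup_le hy h'))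
      obtain ⟨b', hb', h'⟩ := exists_latticeFrame_of_sup_eq ((latticeFrame P).rel_swap hP) hc
      have h'' := (latticeFrame P).rel_swap h'
      exact ⟨(a, y₁), ha, (b', y₂), hY b b' y₂ hy₂ hb'.symm hb,
        Prod.ext h''.1 hQ.1, Prod.ext h''.2 hQ.2⟩
    · obtain ⟨a', ha', h'⟩ := exists_latticeFrame_of_sup_eq hP hc
      exact ⟨(a', y₁), hX a a' y₁ hy ha'.symm ha, (b, y₂), hb,
        Prod.ext h'.1 hQ.1, Prod.ext h'.2 hQ.2⟩
  conv_mem h := h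
  ident_mem x x' y hy _ h := by
    have h' : (x, y) = (⊥, ⊥) := h
    exact absurd ((Prod.mk.inj h').2.le.trans bot_le) hy

lemma principalIdeal_mem_of_le {d x : P} (w y : Q) (h : d ≤ x) :
    principalIdeal (x, y) ∈ (saturatedSubalgebra d w).carrier :=
  show IsSaturated d w (Set.Iic (x, y)) from fun _ _ _ _ ha h' =>
  ⟨le_sup_left.trans (ha.ge.trans (sup_le h'.1 h)), h'.2⟩

lemma principalIdeal_mem_of_le_right (d x : P) {w y : Q} (h : y ≤ w) :
    principalIdeal (x, y) ∈ (saturatedSubalgebra d w).carrier :=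
  show IsSaturated d w (Set.Iic (x, y)) from fun _ _ _ hz _ h' =>
  absurd (h'.2.trans h) hz

end Saturated

/-! ### The epimorphism -/

section Epimorphism

variable {P Q : Type u} [Lattice P] [OrderBot P] [IsModularLattice P]
  [Lattice Q] [OrderBot Q] [IsModularLattice Q]
  {d₁ d₂ d₃ p₁₂ p₁₃ p₂₃ : P} {s₁ s₂ s₃ q₁₂ q₁₃ q₂₃ : Q} {w : Q}
  {C : Type v} [RelationAlgebra C]

/-- Homomorphisms that agree on the saturated sets agree on the ideal of `(⊥, s₁)`: as equivalence
elements of `C`, the two images of this ideal are complements of the common image of `(d₁, ⊥)` in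
the common image of `(d₁, s₁)`. -/
lemma principalIdeal_eq_of_eqOn
    (hP : IsFrame d₁ d₂ d₃ p₁₂ p₁₃ p₂₃) (hQ : IsFrame s₁ s₂ s₃ q₁₂ q₁₃ q₂₃)
    (charP : fourthHarmonic d₁ d₂ d₃ p₁₃ p₂₃ ≤ p₁₂)
    (charQ : s₁ ≤ q₁₂ ⊔ fourthHarmonic s₁ s₂ s₃ q₁₃ q₂₃)
    (hC : ∀ a b : C, a ⨾ b = b ⨾ a) {g h : RelAlgHom (LatticeComplexAlgebra (P × Q)) C}
    (hgh : ∀ X ∈ (saturatedSubalgebra d₁ w).carrier, g X = h X) :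
    g (principalIdeal (⊥, s₁)) = h (principalIdeal (⊥, s₁)) := by
  have key : ∀ {g h : RelAlgHom (LatticeComplexAlgebra (P × Q)) C},
      (∀ X ∈ (saturatedSubalgebra d₁ w).carrier, g X = h X) →
      g (principalIdeal (⊥, s₁)) ≤ h (principalIdeal (⊥, s₁)) := by
    intro g h hgh
    let _ := EquivalenceElement.lattice hC
    let _ : OrderBot (EquivalenceElement C) :=
      { bot := ⟨RelAlgOps.ident, le_rfl, RelationAlgebra.conv_ident, RelationAlgebra.comp_ident _⟩
        bot_le := fun e => e.2.1 }
    have := EquivalenceElement.isModularLattice hC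
    have hbot : ∀ g : RelAlgHom (LatticeComplexAlgebra (P × Q)) C, g.idealHom hC (⊥, ⊥) = ⊥ :=
      fun g => Subtype.ext ((congrArg g principalIdeal_bot).trans g.map_ident)
    have hd : g.idealHom hC (d₁, ⊥) = h.idealHom hC (d₁, ⊥) :=
      Subtype.ext (hgh _ (principalIdeal_mem_of_le _ _ le_rfl))
    have hds : g.idealHom hC (d₁, s₁) = h.idealHom hC (d₁, s₁) :=
      Subtype.ext (hgh _ (principalIdeal_mem_of_le _ _ le_rfl))
    refine le_of_complement hP hQ charP charQ (g.idealHom hC) (hbot g)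
      (f := h.idealHom hC (⊥, s₁)) ?_ ?_
    · rw [hd, ← map_inf, Prod.mk_inf_mk, bot_inf_eq, inf_bot_eq, hbot]
    · rw [hd, hds, ← map_sup, Prod.mk_sup_mk, bot_sup_eq, sup_bot_eq]
  exact le_antisymm (key hgh) (key fun X hX => (hgh X hX).symm)

/-- Homomorphisms that agree on the saturated sets and on the ideal of `(⊥, s)`, where `s ⊔ w` is
the top element, agree everywhere.  By finiteness it is enough to consider points.  A point is the
fusion of a point over `⊥`, which is saturated, and of the intersection of a saturated set with the ideal
of `(⊥, s ⊔ w)`; this ideal is the fusion of the ideal of `(⊥, s)` and of a saturated ideal. -/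
lemma eq_of_eqOn_saturatedSubalgebra [Finite P] [Finite Q] {d : P} {s : Q}
    (hw : ∀ y, y ≤ s ⊔ w) {g h : RelAlgHom (LatticeComplexAlgebra (P × Q)) C}
    (hgh : ∀ X ∈ (saturatedSubalgebra d w).carrier, g X = h X)
    (hs : g (principalIdeal (⊥, s)) = h (principalIdeal (⊥, s))) (X) : g X = h X := by
  have h1 : g (principalIdeal (⊥, s ⊔ w)) = h (principalIdeal (⊥, s ⊔ w)) := by
    have e : principalIdeal ((⊥ : P), s ⊔ w) = principalIdeal (⊥, s) ⨾ principalIdeal (⊥, w) := by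
      rw [principalIdeal_comp, Prod.mk_sup_mk, sup_idem]
    rw [e, g.map_comp, h.map_comp, hs, hgh _ (principalIdeal_mem_of_le_right _ _ le_rfl)]
  have h2 : ∀ z : P × Q, g ({z} : Set (P × Q)) = h ({z} : Set (P × Q)) := by
    rintro ⟨x, y⟩
    let X₁ : LatticeComplexAlgebra (P × Q) := ({(x, ⊥)} : Set (P × Q))
    let X₂ : LatticeComplexAlgebra (P × Q) := ({z | z.2 = y} : Set (P × Q))
    have e : (({(x, y)} : Set (P × Q)) : LatticeComplexAlgebra (P × Q)) =
        X₁ ⨾ (principalIdeal (⊥, s ⊔ w) ⊓ X₂) := by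
      refine Set.ext fun z => ⟨?_, ?_⟩
      · rintro rfl
        refine ⟨(x, ⊥), rfl, (⊥, y),
          fun h' => h'.elim (fun h' => h' ⟨le_rfl, hw y⟩) fun h' => h' rfl, ?_⟩
        constructor <;> simp
      · rintro ⟨_, rfl, ⟨a, b⟩, hb, h', h''⟩
        have hb' : (a, b) ≤ (⊥, s ⊔ w) ∧ b = y := by
          by_contra hc
          exact hb (not_and_or.1 hc)
        obtain ⟨⟨ha, -⟩, rfl⟩ := hb'
        obtain rfl : a = ⊥ := le_bot_iff.1 ha
        simp only [Prod.ext_iff, Prod.fst_sup, Prod.snd_sup, sup_bot_eq, bot_sup_eq] at h' h''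
        exact Prod.ext (h''.1.symm.trans h'.1.symm) h'.2.symm
    have hX₁ : X₁ ∈ (saturatedSubalgebra d w).carrier := by
      change IsSaturated d w {(x, ⊥)}
      intro a a' z hz _ h'
      exact absurd ((Prod.mk.inj (show (a, z) = (x, ⊥) from h')).2.le.trans bot_le) hz
    have hX₂ : X₂ ∈ (saturatedSubalgebra d w).carrier :=
      show IsSaturated d w {z | z.2 = y} from fun _ _ _ _ _ h' => h'
    rw [e, g.map_comp, h.map_comp, g.map_inf, h.map_inf, h1, hgh _ hX₁, hgh _ hX₂]
  have h3 : ∀ S : Set (P × Q), S.Finite → g S = h S := by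
    intro S hS
    induction S, hS using Set.Finite.induction_on with
    | empty => exact hgh _ (show IsSaturated d w ∅ from fun _ _ _ _ _ h' => h')
    | insert _ _ ih =>
      rw [Set.insert_eq]
      exact (g.map_sup _ _).trans ((congrArg₂ _ (h2 _) ih).trans (h.map_sup _ _).symm)
  exact h3 X (Set.toFinite (X : Set (P × Q)))

end Epimorphism

/-- The subalgebra of all elements. -/
def fullSubalgebra (A : Type u) [RelationAlgebra A] : RelSubalgebra A where
  carrier := Set.univ
  sup_mem _ _ := trivial
  compl_mem _ := trivial
  comp_mem _ _ := trivial
  conv_mem _ := trivial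
  ident_mem := trivial

/-- The inclusion of a subalgebra in the algebra of all elements. -/
def RelSubalgebra.toFull {A : Type u} [RelationAlgebra A] (S : RelSubalgebra A) :
    RelAlgHom S.carrier (fullSubalgebra A).carrier where
  toFun a := ⟨a.1, trivial⟩
  map_sup _ _ := rfl
  map_compl _ := rfl
  map_comp _ _ := rfl
  map_conv _ := rfl
  map_ident := rfl

/-- Restriction of a homomorphism along the isomorphism of `A` with its subalgebra of all
elements. -/
def RelAlgHom.ofFull {A : Type u} [RelationAlgebra A] {C : Type v} [RelationAlgebra C]
    (g : RelAlgHom (fullSubalgebra A).carrier C) : RelAlgHom A C where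
  toFun a := g ⟨a, trivial⟩
  map_sup _ _ := g.map_sup ⟨_, trivial⟩ ⟨_, trivial⟩
  map_compl _ := g.map_compl ⟨_, trivial⟩
  map_comp _ _ := g.map_comp ⟨_, trivial⟩ ⟨_, trivial⟩
  map_conv _ := g.map_conv ⟨_, trivial⟩
  map_ident := g.map_ident

theorem mainTheorem1 (R : Set RelAlg.{u}) (hLRA : LRA.{u} ⊆ R) (hARA : R ⊆ ARA.{u}) :
    ¬ HasES R := by
  intro hES
  let K := ULift.{u} (ZMod 2)
  let F := ULift.{u} (ZMod 3)
  have hK : (2 : K) = 0 := ULift.ext _ _ (by decide : (2 : ZMod 2) = 0)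
  have hF : (2 : F) ≠ 0 := fun h => by
    have h' : (2 : ZMod 3) = 0 := congrArg ULift.down h
    exact absurd h' (by decide)
  let P := Submodule K (Fin 3 → K)
  let Q := Submodule F (Fin 3 → F)
  let d : P := axis K 1 2
  let w : Q := axis F 0 2 ⊔ axis F 0 1
  let S := saturatedSubalgebra d w
  have hA : RelAlg.of S.carrier ∈ R := hLRA ⟨P × Q, _, _, _, S, rfl⟩
  have hB : RelAlg.of (fullSubalgebra (LatticeComplexAlgebra (P × Q))).carrier ∈ R :=
    hLRA ⟨P × Q, _, _, _, _, rfl⟩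
  have hepi : IsEpiIn R (A := RelAlg.of S.carrier)
      (B := RelAlg.of (fullSubalgebra (LatticeComplexAlgebra (P × Q))).carrier) S.toFull := by
    intro C hC g h hgh
    have h1 : ∀ X ∈ S.carrier, RelAlgHom.ofFull g X = RelAlgHom.ofFull h X :=
      fun X hX => hgh ⟨X, hX⟩
    have h2 := principalIdeal_eq_of_eqOn isFrame_axis_diagonal isFrame_axis_diagonal
      (fourthHarmonic_le_diagonal hK) (axis_le_diagonal_sup_fourthHarmonic hF) (hARA hC) h1
    have h3 := eq_of_eqOn_saturatedSubalgebra (w := w)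
      (fun y => le_top.trans axis_sup_plane.ge) h1 h2
    have h4 : g.toFun = h.toFun := funext fun X => h3 X.1
    cases g
    cases h
    congr
  obtain ⟨⟨X, hX⟩, hX'⟩ := hES _ hA _ hB _ hepi ⟨principalIdeal (⊥, ⊤), trivial⟩
  have hX'' : X = principalIdeal (⊥, ⊤) := congrArg Subtype.val hX'
  rw [hX''] at hX
  replace hX : IsSaturated d w (Set.Iic (⊥, ⊤)) := hX
  -- Saturation would put `(d, ⊤)` into the ideal of `(⊥, ⊤)`.
  have hw : ¬ (⊤ : Q) ≤ w := fun h => by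
    obtain ⟨v, -, hv⟩ := exists_axis_ne_zero (K := F)
    exact hv (mem_axis_sup_axis₁₂.1 (h (Submodule.mem_top (x := v))))
  have hd : (d, (⊤ : Q)) ≤ (⊥, ⊤) := hX ⊥ d ⊤ hw (by simp) (le_refl ((⊥, ⊤) : P × Q))
  obtain ⟨v, hv, hv'⟩ := exists_axis_ne_zero (K := K)
  have hv'' := (Submodule.mem_bot K).1 (hd.1 hv)
  exact hv' (by rw [hv'']; rfl)
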